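/- Let $n\ge 1$. A function $r:\mathbb{R}^n\to\mathbb{R}$ is called slowly-varying if $r\ge 0$ everywhere and for every $0<c<1$ there is $\nu>0$ such that $|r(x)-r(y)|\le c\,r(x)$ whenever $x,y\in\mathbb{R}^n$ satisfy $|x-y|\le \nu\, r(x)$. A dyadic cube is a set $Q=\prod_{i=1}^n[2^k m_i,2^k(m_i+1))$ with $k,m_1,\dots,m_n\in\mathbb{Z}$, and $\lambda Q$ denotes the closed cube with the same center as $Q$ and with side length $\lambda 2^k$. For $0<\alpha\le 1$ and $f:\mathbb{R}^n\to\mathbb{R}$, let \[ [f]_\alpha(x)=\limsup_{\substack{y,z\to x\\ y\ne z}}\frac{|f(z)-f(y)|}{|z-y|^\alpha}\in[0,\infty]. \] Theorem. Let $r:\mathbb{R}^n\to\mathbb{R}$ be slowly-varying and let $1<\lambda<\frac32$. Then there exist a sequence of distinct dyadic cubes $(Q_j)_{j\ge 1}$ and non-negative functions $\psi_j\in C^\infty(\mathbb{R}^n)$, $j\ge1$, such that $\operatorname{supp}\psi_j\subseteq\lambda Q_j$ for every $j$, \[ \sum_{j=1}^\infty\psi_j^2=\chi_{\{r>0\}}\quad\text{pointwise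 on }\mathbb{R}^n, \] and the following properties hold. (1) For every $x\in\mathbb{R}^n$, at most $2^n$ of the numbers $\psi_j(x)$ are non-zero. (2) For every multi-index $\beta$ there is a constant $C>0$ such that $|\partial^\beta\psi_j(x)|\le C\,r(x)^{-|\beta|}$ for all $j$ and all $x$ with $r(x)>0$. (3) For every multi-index $\beta$ and every $0<\alpha\le1$ there is a constant $C>0$ such that $[\partial^\beta\psi_j]_\alpha(x)\le C\,r(x)^{-\alpha-|\beta|}$ for all $j$ and all $x$ with $r(x)>0$. (4) The family $(\psi_j)$ can be partitioned into $4^n-2^n$ (possibly empty) collections, such that any two different members of the same collection have disjoint supports. (5) If $n=2$, then $(\psi_j)$ can be partitioned in this way into $9$ collections. Here the support of a function is the closure of the set where it is non-zero. -/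

import Mathlib

open Filter Topology
open scoped ContDiff

noncomputable section

/-- Slowly-varying functions on Euclidean `n`-space: `r ≥ 0`, and for every `0 < c < 1` there is
`ν > 0` such that `|r x - r y| ≤ c * r x` whenever `|x - y| ≤ ν * r x`. -/
def SlowlyVarying {n : ℕ} (r : EuclideanSpace ℝ (Fin n) → ℝ) : Prop :=
  (∀ x, 0 ≤ r x) ∧
    ∀ c : ℝ, 0 < c → c < 1 → ∃ ν : ℝ, 0 < ν ∧
      ∀ x y : EuclideanSpace ℝ (Fin n), ‖x - y‖ ≤ ν * r x → |r x - r y| ≤ c * r x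

/-- The dyadic cubes of Euclidean `n`-space, given by their scale and position: the cube with data
`k`, `m` is the product of the intervals `[2 ^ k * m i, 2 ^ k * (m i + 1))`. -/
@[ext]
structure DyadicCube (n : ℕ) where
  k : ℤ
  m : Fin n → ℤ

namespace DyadicCube

variable {n : ℕ}

/-- The side length of a dyadic cube. -/
def side (Q : DyadicCube n) : ℝ := (2 : ℝ) ^ Q.k

/-- The points of a dyadic cube. -/
def toSet (Q : DyadicCube n) : Set (EuclideanSpace ℝ (Fin n)) :=
  {x | ∀ i, Q.side * (Q.m i : ℝ) ≤ x i ∧ x i < Q.side * ((Q.m i : ℝ) + 1)}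

/-- The center of a dyadic cube. -/
def center (Q : DyadicCube n) : EuclideanSpace ℝ (Fin n) :=
  WithLp.toLp 2 fun i => Q.side * ((Q.m i : ℝ) + 1 / 2)

/-- The (closed) dilated cube `lam Q`, with the same center as `Q` and side length
`lam * side Q`. -/
def dilate (lam : ℝ) (Q : DyadicCube n) : Set (EuclideanSpace ℝ (Fin n)) :=
  {x | ∀ i, |x i - Q.center i| ≤ lam * Q.side / 2}

theorem toSet_subset_dilate (Q : DyadicCube n) {lam : ℝ} (h : 1 ≤ lam) :
    Q.toSet ⊆ Q.dilate lam := by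
  intro x hx i
  have hs : 0 < Q.side := zpow_pos (by norm_num) _
  have hc : Q.center i = Q.side * ((Q.m i : ℝ) + 1 / 2) := rfl
  have h₁ := (hx i).1
  have h₂ := (hx i).2
  rw [hc, abs_le]
  constructor <;> nlinarith

end DyadicCube

/-- The `i`-th partial derivative of a function on Euclidean `n`-space. -/
def partialDeriv {n : ℕ} (i : Fin n) (f : EuclideanSpace ℝ (Fin n) → ℝ) :
    EuclideanSpace ℝ (Fin n) → ℝ :=
  fun x => lineDeriv ℝ f x (EuclideanSpace.single i 1)

/-- The derivative of multi-index `β`: apply the `i`-th partial derivative `β i` times,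
for each coordinate `i`. -/
def multiDeriv {n : ℕ} (β : Fin n → ℕ) (f : EuclideanSpace ℝ (Fin n) → ℝ) :
    EuclideanSpace ℝ (Fin n) → ℝ :=
  (List.finRange n).foldr (fun i g => (partialDeriv i)^[β i] g) f

/-- The pointwise Hölder semi-norm: the upper limit of `|f z - f y| / |z - y| ^ α` as `z, y → x`,
`z ≠ y`, as a number in `[0, ∞]`. -/
def holderSeminormAt {n : ℕ} (α : ℝ) (f : EuclideanSpace ℝ (Fin n) → ℝ)
    (x : EuclideanSpace ℝ (Fin n)) : ENNReal :=
  limsup (fun p : EuclideanSpace ℝ (Fin n) × EuclideanSpace ℝ (Fin n) =>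
      ENNReal.ofReal (|f p.1 - f p.2| / ‖p.1 - p.2‖ ^ α))
    (𝓝[{p | p.1 ≠ p.2}] (x, x))

end

noncomputable section

/-! ### Dyadic cubes containing a point -/

/-! Choose δ so small that r changes by at most the fraction 1/8 over distances 2nδr, and take the
maximal dyadic cubes whose side is at most δr on the cube. They partition {r > 0}. Maximality and
slow variation make δr comparable to the side on the doubled cube (`SlowAt.side_bounds`), so doubled
cubes that meet have sides of ratio at most 2 (`SlowAt.k_le`). Tensor-product bumps, equal to 1 on
the cube and supported in its dilate by min(λ, 9/8), are divided by the square root of the sum of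
their squares.

The uniform derivative bounds come from finiteness, not from differentiating the quotient. After
rescaling a cube to unit size, only finitely many arrangements of its neighbours occur
(`exists_place_eq`), so the largest of finitely many constants serves all cubes
(`exists_bound_multiDeriv_normBump`). Scaling back produces powers of the side, hence of r; a
Lipschitz bound at the scale of the cube gives the Hölder bound.

For the counting, contract the 9/8-dilate of a cube into the cube by a small displacement. A grid
cell of smaller or equal scale containing the displaced point lies in the cube, so different cubes
own different cells, and only grid cells near a point need counting. This gives 2^n overlaps
(`SlowAt.encard_le`) and at most 3^n - 1 neighbours no smaller than a given cube. Greedy colouring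
and compactness then yield 3^n colours, which is 9 for n = 2 and at most 4^n - 2^n for n ≥ 2. For n
= 1 only 2 colours are allowed, and removing leftmost intervals first achieves this. -/

theorem EuclideanSpace.norm_le_card_mul {n : ℕ} {v : EuclideanSpace ℝ (Fin n)} {a : ℝ}
    (h : ∀ i, |v i| ≤ a) : ‖v‖ ≤ n * a := by
  calc ‖v‖ = ‖∑ i, v i • EuclideanSpace.single i (1 : ℝ)‖ := by
        congr 1
        ext j
        simp [Finset.sum_apply, Pi.single_apply]
    _ ≤ ∑ i, ‖v i • EuclideanSpace.single i (1 : ℝ)‖ := norm_sum_le _ _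
    _ ≤ ∑ _i : Fin n, a := by
        refine Finset.sum_le_sum fun i _ => ?_
        rw [norm_smul]
        simpa using h i
    _ = n * a := by simp

namespace DyadicCube

variable {n : ℕ}

theorem side_pos (Q : DyadicCube n) : 0 < Q.side := zpow_pos (by norm_num) _

theorem center_apply (Q : DyadicCube n) (i : Fin n) :
    Q.center i = Q.side * ((Q.m i : ℝ) + 1 / 2) := rfl

/-- The dyadic cube of side length `2 ^ k` that contains the point `x`. -/
def containing (k : ℤ) (x : EuclideanSpace ℝ (Fin n)) : DyadicCube n :=
  ⟨k, fun i => ⌊x i / (2 : ℝ) ^ k⌋⟩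

/-- The dyadic cube of twice the side length that contains a given dyadic cube. -/
def parent (Q : DyadicCube n) : DyadicCube n := ⟨Q.k + 1, fun i => Q.m i / 2⟩

/-- Turns membership into an equation between cubes, so that nesting of dyadic cubes becomes
rewriting along `parent_containing`. -/
theorem mem_toSet_iff {Q : DyadicCube n} {x : EuclideanSpace ℝ (Fin n)} :
    x ∈ Q.toSet ↔ containing Q.k x = Q := by
  have hs := Q.side_pos
  have key : ∀ i, (Q.side * (Q.m i : ℝ) ≤ x i ∧ x i < Q.side * ((Q.m i : ℝ) + 1)) ↔
      ⌊x i / (2 : ℝ) ^ Q.k⌋ = Q.m i := by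
    intro i
    rw [Int.floor_eq_iff, ← side, le_div_iff₀ hs, div_lt_iff₀ hs, mul_comm Q.side,
      mul_comm Q.side]
  constructor
  · intro h
    exact DyadicCube.ext rfl (funext fun i => (key i).1 (h i))
  · intro h i
    exact (key i).2 (congrFun (congrArg DyadicCube.m h) i)

theorem mem_containing (k : ℤ) (x : EuclideanSpace ℝ (Fin n)) : x ∈ (containing k x).toSet :=
  mem_toSet_iff.2 rfl

theorem center_mem (Q : DyadicCube n) : Q.center ∈ Q.toSet := by
  intro i
  have := Q.side_pos
  rw [center_apply]
  constructor <;> nlinarith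

theorem parent_containing (k : ℤ) (x : EuclideanSpace ℝ (Fin n)) :
    (containing k x).parent = containing (k + 1) x := by
  refine DyadicCube.ext rfl (funext fun i => ?_)
  have h := Int.floor_div_natCast (x i / (2 : ℝ) ^ k) 2
  rw [div_div] at h
  simp only [parent, containing, zpow_add_one₀ (two_ne_zero' ℝ)]
  exact_mod_cast h.symm

theorem containing_eq_of_le {k k' : ℤ} (hk : k ≤ k') {x y : EuclideanSpace ℝ (Fin n)}
    (h : containing k x = containing k y) : containing k' x = containing k' y := by
  induction k', hk using Int.leInduction with
  | base => exact h
  | succ j _ ih => rw [← parent_containing, ih, parent_containing]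

theorem mem_parent {Q : DyadicCube n} {x : EuclideanSpace ℝ (Fin n)} (h : x ∈ Q.toSet) :
    x ∈ Q.parent.toSet := by
  rw [mem_toSet_iff] at h ⊢
  rw [show Q.parent.k = Q.k + 1 from rfl, ← parent_containing, h]

theorem side_parent (Q : DyadicCube n) : Q.parent.side = 2 * Q.side := by
  simp only [side, parent, zpow_add_one₀ (two_ne_zero' ℝ)]
  ring

theorem abs_sub_le_of_mem {Q : DyadicCube n} {x y : EuclideanSpace ℝ (Fin n)}
    (hx : x ∈ Q.toSet) (hy : y ∈ Q.toSet) (i : Fin n) : |x i - y i| ≤ Q.side := by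
  have := hx i
  have := hy i
  rw [abs_le]
  constructor <;> nlinarith

theorem norm_sub_le_of_mem {Q : DyadicCube n} {x y : EuclideanSpace ℝ (Fin n)}
    (hx : x ∈ Q.toSet) (hy : y ∈ Q.toSet) : ‖x - y‖ ≤ n * Q.side :=
  EuclideanSpace.norm_le_card_mul fun i => abs_sub_le_of_mem hx hy i

theorem dilate_mono {a b : ℝ} (h : a ≤ b) (Q : DyadicCube n) : Q.dilate a ⊆ Q.dilate b := by
  intro x hx i
  have := hx i
  have := Q.side_pos
  nlinarith

theorem isClosed_dilate (Q : DyadicCube n) (a : ℝ) : IsClosed (Q.dilate a) := by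
  simp only [dilate, Set.ofPred_forall]
  refine isClosed_iInter fun i => isClosed_le ?_ continuous_const
  fun_prop

theorem isCompact_dilate (Q : DyadicCube n) (a : ℝ) : IsCompact (Q.dilate a) := by
  refine Metric.isCompact_of_isClosed_isBounded (Q.isClosed_dilate a) ?_
  refine (Metric.isBounded_iff_subset_closedBall Q.center).2 ⟨n * |a * Q.side / 2|, fun x hx => ?_⟩
  rw [Metric.mem_closedBall, dist_eq_norm]
  exact EuclideanSpace.norm_le_card_mul fun i => (hx i).trans (le_abs_self _)

theorem side_le_side {Q P : DyadicCube n} (h : Q.k ≤ P.k) : Q.side ≤ P.side :=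
  zpow_le_zpow_right₀ (by norm_num) h

theorem side_le_two_mul {Q P : DyadicCube n} (h : Q.k ≤ P.k + 1) : Q.side ≤ 2 * P.side := by
  rw [← side_parent]
  exact side_le_side h

theorem k_le_of_side_lt {Q P : DyadicCube n} (h : Q.side < 4 * P.side) : Q.k ≤ P.k + 1 := by
  by_contra! hk
  have : P.parent.parent.side ≤ Q.side := side_le_side (by simp only [parent]; omega)
  rw [side_parent, side_parent] at this
  linarith

/-- The image of `x` under the contraction by `7 / 8` towards the center of `Q`. -/
def contract (Q : DyadicCube n) (x : EuclideanSpace ℝ (Fin n)) : EuclideanSpace ℝ (Fin n) :=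
  Q.center + (7 / 8 : ℝ) • (x - Q.center)

/-- Since 7/8 · 9/8 = 63/64 < 1, the image stays clear of the faces, so the half-open boundary
causes no trouble. -/
theorem contract_mem {Q : DyadicCube n} {x : EuclideanSpace ℝ (Fin n)}
    (hx : x ∈ Q.dilate (9 / 8)) : Q.contract x ∈ Q.toSet := by
  intro i
  have hs := Q.side_pos
  have h := abs_le.1 (hx i)
  have hc := Q.center_apply i
  simp only [contract, PiLp.add_apply, PiLp.smul_apply, PiLp.sub_apply, smul_eq_mul]
  constructor <;> nlinarith

theorem abs_contract_sub_le {Q : DyadicCube n} {x : EuclideanSpace ℝ (Fin n)}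
    (hx : x ∈ Q.dilate (9 / 8)) (i : Fin n) : |Q.contract x i - x i| ≤ 9 / 128 * Q.side := by
  have h := abs_le.1 (hx i)
  simp only [contract, PiLp.add_apply, PiLp.smul_apply, PiLp.sub_apply, smul_eq_mul]
  rw [abs_le]
  constructor <;> linarith

end DyadicCube

/-! ### The Whitney decomposition given by a slowly-varying function -/

/-- The maximal cubes among the dyadic cubes `Q` with `Q.side ≤ δ * r` on `Q`. -/
def DyadicCube.IsWhitney {n : ℕ} (r : EuclideanSpace ℝ (Fin n) → ℝ) (δ : ℝ) (Q : DyadicCube n) :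
    Prop :=
  (∀ y ∈ Q.toSet, Q.side ≤ δ * r y) ∧ ∃ y ∈ Q.parent.toSet, δ * r y < 2 * Q.side

/-- `r` varies little at distances comparable with `δ * r`. -/
structure SlowAt {n : ℕ} (r : EuclideanSpace ℝ (Fin n) → ℝ) (δ : ℝ) : Prop where
  pos : 0 < δ
  dim_pos : 0 < n
  abs_sub_le : ∀ x y, ‖x - y‖ ≤ 2 * n * (δ * r x) → |r x - r y| ≤ 1 / 8 * r x

theorem SlowlyVarying.exists_slowAt {n : ℕ} (hn : 1 ≤ n) {r : EuclideanSpace ℝ (Fin n) → ℝ}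
    (hr : SlowlyVarying r) : ∃ δ, SlowAt r δ := by
  obtain ⟨-, h⟩ := hr
  obtain ⟨ν, hν, h⟩ := h (1 / 8) (by norm_num) (by norm_num)
  have hn' : (0 : ℝ) < n := by exact_mod_cast hn
  -- This makes 2nδ = ν; the factor 2n allows for the diameter of a parent cube, at most n times
  -- twice the side.
  refine ⟨ν / (2 * n), by positivity, hn, fun x y hxy => h x y ?_⟩
  rwa [← mul_assoc, mul_div_cancel₀ _ (by positivity)] at hxy

namespace SlowAt

open DyadicCube

variable {n : ℕ} {r : EuclideanSpace ℝ (Fin n) → ℝ} {δ : ℝ}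

/-- Everything is compared with the center c, where δ r(c) ≥ side. Moving to x costs a factor 7/8 or
9/8; moving to the point y of the parent gives δ r(c) ≤ 8/7 · 2 · side, and 9/8 · 16/7 = 18/7. -/
theorem side_bounds (h : SlowAt r δ) {Q : DyadicCube n} (hQ : Q.IsWhitney r δ)
    {x : EuclideanSpace ℝ (Fin n)} (hx : x ∈ Q.dilate 2) :
    7 / 8 * Q.side ≤ δ * r x ∧ δ * r x ≤ 18 / 7 * Q.side := by
  obtain ⟨hadm, y, hy, hyr⟩ := hQ
  have hs := Q.side_pos
  have hn : (0 : ℝ) ≤ n := Nat.cast_nonneg n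
  have hc := hadm _ Q.center_mem
  have hδ := h.pos
  have h1 := abs_le.1 <| h.abs_sub_le Q.center x <| by
    have : ‖Q.center - x‖ ≤ n * Q.side := EuclideanSpace.norm_le_card_mul fun i => by
      rw [PiLp.sub_apply, abs_sub_comm]
      linarith [hx i]
    nlinarith [mul_le_mul_of_nonneg_left hc hn, mul_nonneg hn hs.le]
  have h2 := abs_le.1 <| h.abs_sub_le Q.center y <| by
    have : ‖Q.center - y‖ ≤ n * Q.parent.side := norm_sub_le_of_mem (mem_parent Q.center_mem) hy
    rw [side_parent] at this
    nlinarith [mul_le_mul_of_nonneg_left hc hn]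
  have h3 := mul_le_mul_of_nonneg_left h1.1 hδ.le
  have h4 := mul_le_mul_of_nonneg_left h1.2 hδ.le
  have h5 := mul_le_mul_of_nonneg_left h2.2 hδ.le
  constructor <;> linarith

theorem pos_of_mem_dilate (h : SlowAt r δ) {Q : DyadicCube n} (hQ : Q.IsWhitney r δ)
    {x : EuclideanSpace ℝ (Fin n)} (hx : x ∈ Q.dilate 2) : 0 < r x := by
  have h1 := (h.side_bounds hQ hx).1
  have hs := Q.side_pos
  exact pos_of_mul_pos_right (a := δ) (by linarith) h.pos.le

theorem k_le (h : SlowAt r δ) {Q P : DyadicCube n} (hQ : Q.IsWhitney r δ) (hP : P.IsWhitney r δ)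
    {x : EuclideanSpace ℝ (Fin n)} (hx : x ∈ Q.dilate 2) (hx' : x ∈ P.dilate 2) :
    Q.k ≤ P.k + 1 := by
  -- The two bounds give a ratio of at most (8/7)(18/7) = 144/49 < 4, and ratios of sides are powers
  -- of two.
  refine k_le_of_side_lt ?_
  have h1 := (h.side_bounds hQ hx).1
  have h2 := (h.side_bounds hP hx').2
  have := P.side_pos
  linarith

theorem exists_isWhitney (h : SlowAt r δ) {x : EuclideanSpace ℝ (Fin n)} (hx : 0 < r x) :
    ∃ Q : DyadicCube n, Q.IsWhitney r δ ∧ x ∈ Q.toSet := by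
  have hδ := h.pos
  have hn : (1 : ℝ) ≤ n := by exact_mod_cast h.dim_pos
  let P : ℤ → Prop := fun k => ∀ y ∈ (containing k x).toSet, (2 : ℝ) ^ k ≤ δ * r y
  obtain ⟨b, hb⟩ := pow_unbounded_of_one_lt (δ * r x) (one_lt_two (α := ℝ))
  obtain ⟨a, ha⟩ := exists_pow_lt_of_lt_one (y := (1 / 2 : ℝ)) (x := 7 / 8 * (δ * r x))
    (by positivity) (by norm_num)
  -- Admissible scales at x are bounded above by δ r(x), and slow variation makes every sufficiently
  -- small cube around x admissible.
  obtain ⟨k, hk, hmax⟩ := Int.exists_greatest_of_bdd (P := P)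
    ⟨b, fun z hz => by
      by_contra! hlt
      have h1 : (2 : ℝ) ^ (b : ℤ) ≤ 2 ^ z := zpow_le_zpow_right₀ (by norm_num) hlt.le
      have h2 := hz x (mem_containing z x)
      rw [zpow_natCast] at h1
      linarith⟩
    ⟨-(a : ℤ), fun y hy => by
      have hs : (2 : ℝ) ^ (-(a : ℤ)) = (1 / 2) ^ a := by simp
      rw [hs]
      have hd : ‖x - y‖ ≤ n * (1 / 2 : ℝ) ^ a := by
        rw [← hs]
        exact norm_sub_le_of_mem (mem_containing _ x) hy
      have h1 := abs_le.1 <| h.abs_sub_le x y <| by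
        nlinarith [mul_pos hδ hx]
      have := mul_le_mul_of_nonneg_left h1.2 hδ.le
      linarith⟩
  refine ⟨containing k x, ⟨hk, ?_⟩, mem_containing k x⟩
  rw [parent_containing]
  by_contra! hcon
  have : P (k + 1) := fun y hy => by
    rw [zpow_add_one₀ two_ne_zero, mul_comm]
    exact hcon y hy
  linarith [hmax _ this]

end SlowAt

namespace DyadicCube.IsWhitney

open DyadicCube

variable {n : ℕ} {r : EuclideanSpace ℝ (Fin n) → ℝ} {δ : ℝ}

/-- A strictly larger P meeting Q would contain the parent of Q, and with it the point that
witnesses the maximality of Q. -/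
theorem k_le_of_mem {Q P : DyadicCube n} (hQ : Q.IsWhitney r δ) (hP : P.IsWhitney r δ)
    {x : EuclideanSpace ℝ (Fin n)} (hx : x ∈ Q.toSet) (hx' : x ∈ P.toSet) : P.k ≤ Q.k := by
  by_contra! hk
  obtain ⟨y, hy, hyr⟩ := hQ.2
  have hyP : y ∈ P.toSet := by
    rw [mem_toSet_iff] at hx hx' hy ⊢
    rw [← hx']
    refine containing_eq_of_le (k := Q.k + 1) hk ?_
    rw [← parent_containing _ x, hx, ← hy]
    rfl
  have h1 := hP.1 y hyP
  have h2 : Q.parent.side ≤ P.side := side_le_side hk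
  rw [side_parent] at h2
  linarith

theorem eq_of_mem {Q P : DyadicCube n} (hQ : Q.IsWhitney r δ) (hP : P.IsWhitney r δ)
    {x : EuclideanSpace ℝ (Fin n)} (hx : x ∈ Q.toSet) (hx' : x ∈ P.toSet) : Q = P := by
  have hk := le_antisymm (k_le_of_mem hP hQ hx' hx) (k_le_of_mem hQ hP hx hx')
  rw [← mem_toSet_iff.1 hx, ← mem_toSet_iff.1 hx', hk]

/-- Whitney cubes of level at least `k` are determined by any cell of level `k` they contain. -/
theorem eq_of_containing_eq {Q P : DyadicCube n} (hQ : Q.IsWhitney r δ) (hP : P.IsWhitney r δ)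
    {k : ℤ} (hk : k ≤ P.k) {x y : EuclideanSpace ℝ (Fin n)} (hx : x ∈ Q.toSet) (hy : y ∈ P.toSet)
    (h : containing k x = containing k y) : Q = P := by
  refine eq_of_mem hQ hP hx (mem_toSet_iff.2 ?_)
  rw [containing_eq_of_le hk h, mem_toSet_iff.1 hy]

end DyadicCube.IsWhitney

/-! ### Colouring the Whitney cubes -/

open Classical in
-- Greedy colouring: colour all but a vertex with fewer than k neighbours; some colour remains free
-- for it.
theorem SimpleGraph.exists_coloring_finset {V : Type*} (G : SimpleGraph V) {k : ℕ}
    (h : ∀ s : Finset V, s.Nonempty → ∃ v ∈ s, (s.filter (G.Adj v)).card < k) (s : Finset V) :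
    ∃ c : V → Fin k, ∀ v ∈ s, ∀ w ∈ s, G.Adj v w → c v ≠ c w := by
  induction s using Finset.strongInduction with
  | H s ih =>
    rcases s.eq_empty_or_nonempty with rfl | hs
    -- The colouring is defined on all of `V`, so a colour must exist even when s is empty; the
    -- hypothesis on a singleton forces k > 0.
    · rcases isEmpty_or_nonempty V with hV | ⟨⟨v⟩⟩
      · exact ⟨isEmptyElim, by simp⟩
      · obtain ⟨_, _, hk⟩ := h {v} (Finset.singleton_nonempty v)
        exact ⟨fun _ => ⟨0, by omega⟩, by simp⟩
    · obtain ⟨v, hv, hk⟩ := h s hs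
      obtain ⟨c, hc⟩ := ih (s.erase v) (Finset.erase_ssubset hv)
      obtain ⟨a, ha⟩ : ∃ a, a ∉ (s.filter (G.Adj v)).image c := by
        by_contra! hall
        have h1 : (Finset.univ : Finset (Fin k)) ⊆ (s.filter (G.Adj v)).image c :=
          fun a _ => hall a
        have h2 := (Finset.card_le_card h1).trans Finset.card_image_le
        rw [Finset.card_univ, Fintype.card_fin] at h2
        omega
      have hne : ∀ w ∈ s, G.Adj v w → c w ≠ a := fun w hw hvw hcw =>
        ha (Finset.mem_image.2 ⟨w, Finset.mem_filter.2 ⟨hw, hvw⟩, hcw⟩)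
      refine ⟨Function.update c v a, fun x hx y hy hxy => ?_⟩
      by_cases hxv : x = v
      · subst hxv
        rw [Function.update_self, Function.update_of_ne hxy.ne']
        exact (hne y hy hxy).symm
      · by_cases hyv : y = v
        · subst hyv
          rw [Function.update_self, Function.update_of_ne hxv]
          exact hne x hx hxy.symm
        · rw [Function.update_of_ne hxv, Function.update_of_ne hyv]
          exact hc x (Finset.mem_erase.2 ⟨hxv, hx⟩) y (Finset.mem_erase.2 ⟨hyv, hy⟩) hxy

open Classical in
/-- A graph all of whose finite sets of vertices have a vertex with less than `k` neighbours in the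
set is `k`-colourable. -/
theorem SimpleGraph.colorable_of_degenerate {V : Type*} (G : SimpleGraph V) {k : ℕ}
    (h : ∀ s : Finset V, s.Nonempty → ∃ v ∈ s, (s.filter (G.Adj v)).card < k) :
    G.Colorable k := by
  -- De Bruijn–Erdős compactness reduces to finite subgraphs.
  refine SimpleGraph.nonempty_hom_of_forall_finite_subgraph_hom fun G' hG' => Nonempty.some ?_
  obtain ⟨c, hc⟩ := G.exists_coloring_finset h hG'.toFinset
  exact ⟨SimpleGraph.Coloring.mk (fun v => c v) fun {v w} hvw =>
    hc v (by simp) w (by simp) (G'.adj_sub hvw)⟩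

/-- Two different Whitney cubes are adjacent if their dilates by `9 / 8` intersect. -/
def whitneyGraph {n : ℕ} (r : EuclideanSpace ℝ (Fin n) → ℝ) (δ : ℝ) :
    SimpleGraph {Q : DyadicCube n // Q.IsWhitney r δ} where
  Adj Q P := Q ≠ P ∧ (Q.1.dilate (9 / 8) ∩ P.1.dilate (9 / 8)).Nonempty
  symm := ⟨fun _ _ h => ⟨h.1.symm, Set.inter_comm _ _ ▸ h.2⟩⟩
  loopless := ⟨fun _ h => h.1 rfl⟩

/-! ### Neighbour counts and overlap bounds. -/

namespace SlowAt

open DyadicCube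

variable {n : ℕ} {r : EuclideanSpace ℝ (Fin n) → ℝ} {δ : ℝ}

theorem k_le_of_adj (h : SlowAt r δ) {Q P : {Q : DyadicCube n // Q.IsWhitney r δ}}
    (hQP : (whitneyGraph r δ).Adj Q P) : Q.1.k ≤ P.1.k + 1 := by
  obtain ⟨-, x, hx, hx'⟩ := hQP
  exact h.k_le Q.2 P.2 (dilate_mono (by norm_num) _ hx) (dilate_mono (by norm_num) _ hx')

/-- Contracting a common point x towards the center of P moves it by at most 9/128 · 2 sides of Q,
and 9/16 + 9/64 = 45/64. -/
theorem exists_mem_of_adj (h : SlowAt r δ) {Q P : {Q : DyadicCube n // Q.IsWhitney r δ}}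
    (hQP : (whitneyGraph r δ).Adj Q P) :
    ∃ p ∈ P.1.toSet, ∀ i, |p i - Q.1.center i| ≤ 45 / 64 * Q.1.side := by
  have hk := h.k_le_of_adj hQP.symm
  obtain ⟨-, x, hx, hx'⟩ := hQP
  refine ⟨_, contract_mem hx', fun i => ?_⟩
  have h1 := abs_le.1 (abs_contract_sub_le hx' i)
  have h2 := abs_le.1 (hx i)
  have h3 := side_le_two_mul hk
  rw [abs_le]
  constructor <;> linarith

open Classical in
-- Remove a cube Q of smallest scale. Each neighbour contains the whole cell of that scale around
-- its point near Q, and these cells are distinct, adjacent to Q and different from Q: at most 3^n -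
-- 1 of them.
theorem colorable_three_pow (h : SlowAt r δ) : (whitneyGraph r δ).Colorable (3 ^ n) := by
  refine SimpleGraph.colorable_of_degenerate _ fun s hs => ?_
  obtain ⟨Q, hQs, hmin⟩ := s.exists_min_image (fun Q => Q.1.k) hs
  refine ⟨Q, hQs, ?_⟩
  let t : Finset (Fin n → ℤ) :=
    (Fintype.piFinset fun i => Finset.Icc (Q.1.m i - 1) (Q.1.m i + 1)).erase Q.1.m
  have ht : t.card < 3 ^ n := by
    have hmem : Q.1.m ∈ Fintype.piFinset fun i => Finset.Icc (Q.1.m i - 1) (Q.1.m i + 1) := by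
      simp
    refine (Finset.card_lt_card (Finset.erase_ssubset hmem)).trans_eq ?_
    rw [Fintype.card_piFinset]
    simp only [Int.card_Icc]
    rw [Finset.prod_congr rfl fun i _ => show (Q.1.m i + 1 + 1 - (Q.1.m i - 1)).toNat = 3 by omega]
    simp
  choose p hp hpQ using fun P (hP : (whitneyGraph r δ).Adj Q P) => h.exists_mem_of_adj hP
  let g : {Q : DyadicCube n // Q.IsWhitney r δ} → Fin n → ℤ := fun P =>
    if hP : (whitneyGraph r δ).Adj Q P then (containing Q.1.k (p P hP)).m else 0
  refine (Finset.card_le_card_of_injOn g ?_ ?_).trans_lt ht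
  · intro P hP
    obtain ⟨hPs, hQP⟩ := Finset.mem_filter.1 hP
    simp only [g, dif_pos hQP]
    refine Finset.mem_coe.2 (Finset.mem_erase.2 ⟨fun heq => hQP.1 ?_, ?_⟩)
    · refine Subtype.ext (Q.2.eq_of_mem P.2 (mem_toSet_iff.2 ?_) (hp P hQP))
      exact DyadicCube.ext rfl heq
    · rw [Fintype.mem_piFinset]
      intro i
      have h1 := abs_le.1 (hpQ P hQP i)
      have h2 := mem_containing Q.1.k (p P hQP) i
      have hs := Q.1.side_pos
      rw [center_apply] at h1
      have hside : (containing Q.1.k (p P hQP)).side = Q.1.side := rfl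
      rw [hside] at h2
      set z : ℤ := (containing Q.1.k (p P hQP)).m i
      have h3 : (Q.1.m i : ℝ) < z + 2 := by
        refine lt_of_mul_lt_mul_left ?_ hs.le
        linarith
      have h4 : (z : ℝ) < Q.1.m i + 2 := by
        refine lt_of_mul_lt_mul_left ?_ hs.le
        linarith
      rw [Finset.mem_Icc]
      constructor
      · have : Q.1.m i < z + 2 := by exact_mod_cast h3
        omega
      · have : z < Q.1.m i + 2 := by exact_mod_cast h4
        omega
  · intro P hP P' hP' heq
    obtain ⟨hPs, hQP⟩ := Finset.mem_filter.1 hP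
    obtain ⟨hPs', hQP'⟩ := Finset.mem_filter.1 hP'
    simp only [g, dif_pos hQP, dif_pos hQP'] at heq
    exact Subtype.ext <| P.2.eq_of_containing_eq P'.2 (hmin P' hPs') (hp P hQP) (hp P' hQP') <|
      DyadicCube.ext rfl heq

open Classical in
-- Remove the interval Q with leftmost center. Its neighbours lie to the right and have at least
-- half its length, and their points are within 45/64 - 1/2 < 1/2 of a length from its right end.
-- All therefore contain the same half-length cell there, so there is at most one.
theorem colorable_two_of_dim_one {r : EuclideanSpace ℝ (Fin 1) → ℝ} (h : SlowAt r δ) :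
    (whitneyGraph r δ).Colorable 2 := by
  refine SimpleGraph.colorable_of_degenerate _ fun s hs => ?_
  obtain ⟨Q, hQs, hmin⟩ := s.exists_min_image (fun Q => Q.1.center 0) hs
  refine ⟨Q, hQs, Nat.lt_succ_of_le (Finset.card_le_one.2 fun P hP P' hP' => ?_)⟩
  have key : ∀ P ∈ s, (whitneyGraph r δ).Adj Q P → ∃ p ∈ P.1.toSet,
      containing (Q.1.k - 1) p = ⟨Q.1.k - 1, fun _ => 2 * Q.1.m 0 + 2⟩ := by
    intro P hP hQP
    obtain ⟨p, hp, hpQ⟩ := h.exists_mem_of_adj hQP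
    refine ⟨p, hp, ?_⟩
    have hs := Q.1.side_pos
    have hQc := Q.1.center_apply 0
    have h1 := abs_le.1 (hpQ 0)
    have hright : Q.1.side * (Q.1.m 0 + 1) ≤ p 0 := by
      by_contra! hlt
      by_cases hle : Q.1.side * Q.1.m 0 ≤ p 0
      · refine hQP.1 (Subtype.ext (Q.2.eq_of_mem P.2 (x := p) (fun i => ?_) hp))
        rw [Subsingleton.elim i 0]
        exact ⟨hle, hlt⟩
      · refine hQP.1 (Subtype.ext (Q.2.eq_of_mem P.2 Q.1.center_mem fun i => ?_))
        rw [Subsingleton.elim i 0]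
        have h2 := hp 0
        have h3 := P.1.center_mem 0
        have h4 := hmin P hP
        constructor <;> linarith
    have hside : (2 : ℝ) ^ (Q.1.k - 1) = Q.1.side / 2 := by
      rw [zpow_sub_one₀ two_ne_zero, side, div_eq_mul_inv]
    refine (mem_toSet_iff (Q := ⟨Q.1.k - 1, fun _ => 2 * Q.1.m 0 + 2⟩)).1 fun i => ?_
    rw [Subsingleton.elim i 0]
    simp only [side, hside]
    rw [← side]
    push_cast
    constructor <;> linarith
  obtain ⟨hPs, hQP⟩ := Finset.mem_filter.1 hP
  obtain ⟨hPs', hQP'⟩ := Finset.mem_filter.1 hP'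
  obtain ⟨p, hp, hpe⟩ := key P hPs hQP
  obtain ⟨p', hp', hpe'⟩ := key P' hPs' hQP'
  have := h.k_le_of_adj hQP'
  exact Subtype.ext <| P.2.eq_of_containing_eq P'.2 (k := Q.1.k - 1) (by omega) hp hp' <|
    hpe.trans hpe'.symm

theorem _root_.three_pow_add_two_pow_le {n : ℕ} (hn : 2 ≤ n) : 3 ^ n + 2 ^ n ≤ 4 ^ n := by
  induction n, hn using Nat.le_induction with
  | base => norm_num
  | succ j _ ih =>
    rw [pow_succ, pow_succ, pow_succ]
    omega

theorem colorable (h : SlowAt r δ) : (whitneyGraph r δ).Colorable (4 ^ n - 2 ^ n) := by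
  obtain rfl | hn : n = 1 ∨ 2 ≤ n := by
    have := h.dim_pos
    omega
  · exact h.colorable_two_of_dim_one
  · exact h.colorable_three_pow.mono (Nat.le_sub_of_add_le (three_pow_add_two_pow_le hn))

/-- The dilates by `9 / 8` of at most `2 ^ n` Whitney cubes have a point in common. -/
theorem encard_le (h : SlowAt r δ) (x : EuclideanSpace ℝ (Fin n)) :
    {Q : DyadicCube n | Q.IsWhitney r δ ∧ x ∈ Q.dilate (9 / 8)}.encard ≤ 2 ^ n := by
  set J := {Q : DyadicCube n | Q.IsWhitney r δ ∧ x ∈ Q.dilate (9 / 8)}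
  rcases J.eq_empty_or_nonempty with hJ | ⟨Q₀, hQ₀⟩
  · simp [hJ]
  have hk : ∀ Q ∈ J, ∀ P ∈ J, Q.k ≤ P.k + 1 := fun Q hQ P hP =>
    h.k_le hQ.1 hP.1 (dilate_mono (by norm_num) _ hQ.2) (dilate_mono (by norm_num) _ hP.2)
  obtain ⟨-, ⟨Q₁, hQ₁, rfl⟩, hmin⟩ := Int.exists_least_of_bdd (P := fun k => ∃ Q ∈ J, Q.k = k)
    ⟨Q₀.k - 1, by
      rintro _ ⟨Q, hQ, rfl⟩
      linarith [hk Q₀ hQ₀ Q hQ]⟩ ⟨_, Q₀, hQ₀, rfl⟩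
  set k := Q₁.k
  have hs : (0 : ℝ) < 2 ^ k := by positivity
  -- In units of the smallest scale, displaced points are within 9/64 < 1/2 of x. An open interval
  -- of length 1 meets at most two unit cells, separated by the integer given by this ceiling.
  let t : Finset (Fin n → ℤ) := Fintype.piFinset fun i =>
    Finset.Icc (⌈x i / 2 ^ k - 1 / 2⌉ - 1) ⌈x i / 2 ^ k - 1 / 2⌉
  have ht : t.card = 2 ^ n := by
    rw [Fintype.card_piFinset]
    simp only [Int.card_Icc]
    rw [Finset.prod_congr rfl fun i _ => show (⌈x i / 2 ^ k - 1 / 2⌉ + 1 -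
      (⌈x i / 2 ^ k - 1 / 2⌉ - 1)).toNat = 2 by omega]
    simp
  have hcard : (t : Set (Fin n → ℤ)).encard = 2 ^ n := by
    rw [Set.encard_coe_eq_coe_finsetCard, ht]
    norm_cast
  rw [← hcard]
  refine Set.encard_le_encard_of_injOn (f := fun Q => (containing k (Q.contract x)).m) ?_ ?_
  · intro Q hQ
    refine Finset.mem_coe.2 (Fintype.mem_piFinset.2 fun i => ?_)
    have h1 := abs_le.1 (abs_contract_sub_le hQ.2 i)
    have h2 : Q.side ≤ 2 * 2 ^ k := side_le_two_mul (hk Q hQ Q₁ hQ₁)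
    have h3 : |Q.contract x i / 2 ^ k - x i / 2 ^ k| ≤ 9 / 64 := by
      rw [← sub_div, abs_le, le_div_iff₀ hs, div_le_iff₀ hs]
      constructor <;> linarith
    have h4 := abs_le.1 h3
    have h5 := Int.lt_floor_add_one (Q.contract x i / 2 ^ k)
    have h6 := Int.floor_le (Q.contract x i / 2 ^ k)
    simp only [containing]
    rw [Finset.mem_Icc, sub_le_iff_le_add, Int.ceil_le, ← Int.sub_one_lt_iff, Int.lt_ceil]
    push_cast
    constructor <;> linarith
  · intro Q hQ P hP heq
    exact hQ.1.eq_of_containing_eq hP.1 (hmin _ ⟨P, hP, rfl⟩) (contract_mem hQ.2)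
      (contract_mem hP.2) (DyadicCube.ext rfl heq)

end SlowAt

/-! ### Partial derivatives -/

section PartialDeriv

variable {n : ℕ}

theorem ContDiff.partialDeriv {f : EuclideanSpace ℝ (Fin n) → ℝ} (hf : ContDiff ℝ ∞ f)
    (i : Fin n) : ContDiff ℝ ∞ (partialDeriv i f) := by
  have h : _root_.partialDeriv i f = fun x => fderiv ℝ f x (EuclideanSpace.single i 1) :=
    funext fun x => (hf.differentiable (by simp) x).lineDeriv_eq_fderiv
  rw [h]
  exact (hf.fderiv_right (by simp)).clm_apply contDiff_const

theorem tsupport_partialDeriv_subset (f : EuclideanSpace ℝ (Fin n) → ℝ) (i : Fin n) :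
    tsupport (partialDeriv i f) ⊆ tsupport f := by
  refine closure_minimal (fun x hx => ?_) (isClosed_tsupport f)
  by_contra hxf
  refine hx ?_
  have h : f =ᶠ[𝓝 x] fun _ => 0 := notMem_tsupport_iff_eventuallyEq.1 hxf
  simp only [partialDeriv]
  rw [h.lineDeriv_eq]
  simp [lineDeriv]

/-- The prefactor c keeps the shape stable, so the identity can be iterated. -/
theorem partialDeriv_mul_comp_smul_sub (f : EuclideanSpace ℝ (Fin n) → ℝ) (i : Fin n) (c a : ℝ)
    (v : EuclideanSpace ℝ (Fin n)) :
    partialDeriv i (fun x => c * f (a • (x - v))) =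
      fun x => c * a * partialDeriv i f (a • (x - v)) := by
  funext x
  simp only [partialDeriv, lineDeriv]
  have h : ∀ t : ℝ, a • (x + t • EuclideanSpace.single i (1 : ℝ) - v) =
      a • (x - v) + (a * t) • EuclideanSpace.single i (1 : ℝ) := fun t => by module
  simp only [h]
  rw [deriv_const_mul_field]
  have := deriv_comp_mul_left a
    (fun t => f (a • (x - v) + t • EuclideanSpace.single i (1 : ℝ))) 0
  rw [this]
  simp [mul_assoc]

/-- Properties stable under all partial derivatives are stable under `multiDeriv`. -/
theorem multiDeriv_induction {p : (EuclideanSpace ℝ (Fin n) → ℝ) → Prop}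
    (hp : ∀ i g, p g → p (partialDeriv i g)) (β : Fin n → ℕ) {f : EuclideanSpace ℝ (Fin n) → ℝ}
    (hf : p f) : p (multiDeriv β f) := by
  unfold multiDeriv
  induction List.finRange n with
  | nil => exact hf
  | cons i l ih => exact Function.Iterate.rec p ih (hp i) (β i)

theorem ContDiff.multiDeriv {f : EuclideanSpace ℝ (Fin n) → ℝ} (hf : ContDiff ℝ ∞ f)
    (β : Fin n → ℕ) : ContDiff ℝ ∞ (multiDeriv β f) :=
  multiDeriv_induction (p := ContDiff ℝ ∞) (fun i _ hg => hg.partialDeriv i) β hf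

theorem tsupport_multiDeriv_subset (f : EuclideanSpace ℝ (Fin n) → ℝ) (β : Fin n → ℕ) :
    tsupport (multiDeriv β f) ⊆ tsupport f :=
  multiDeriv_induction (p := fun g => tsupport g ⊆ tsupport f)
    (fun i g hg => (tsupport_partialDeriv_subset g i).trans hg) β subset_rfl

theorem multiDeriv_comp_smul_sub (f : EuclideanSpace ℝ (Fin n) → ℝ) (β : Fin n → ℕ) (a : ℝ)
    (v : EuclideanSpace ℝ (Fin n)) :
    multiDeriv β (fun x => f (a • (x - v))) =
      fun x => a ^ (∑ i, β i) * multiDeriv β f (a • (x - v)) := by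
  have hiter : ∀ (i : Fin n) (k : ℕ) (c : ℝ) (g : EuclideanSpace ℝ (Fin n) → ℝ),
      (partialDeriv i)^[k] (fun x => c * g (a • (x - v))) =
        fun x => c * a ^ k * (partialDeriv i)^[k] g (a • (x - v)) := by
    intro i k
    induction k with
    | zero => simp
    | succ k ih =>
      intro c g
      rw [Function.iterate_succ_apply, partialDeriv_mul_comp_smul_sub, ih,
        Function.iterate_succ_apply]
      funext x
      ring
  have hlist : ∀ l : List (Fin n),
      l.foldr (fun i g => (partialDeriv i)^[β i] g) (fun x => f (a • (x - v))) =
        fun x => a ^ (l.map β).sum *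
          l.foldr (fun i g => (partialDeriv i)^[β i] g) f (a • (x - v)) := by
    intro l
    induction l with
    | nil => simp
    | cons i l ih =>
      rw [List.foldr_cons, ih, hiter, List.foldr_cons, List.map_cons, List.sum_cons]
      funext x
      ring
  have hsum : ((List.finRange n).map β).sum = ∑ i, β i := by
    rw [Fin.sum_univ_def]
  rw [multiDeriv, hlist, hsum]
  rfl

theorem multiDeriv_zero (β : Fin n → ℕ) : multiDeriv β (0 : EuclideanSpace ℝ (Fin n) → ℝ) = 0 := by
  refine multiDeriv_induction (p := fun g => g = 0) (fun i g hg => ?_) β rfl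
  subst hg
  funext x
  simp [partialDeriv, lineDeriv]

theorem exists_bound_multiDeriv {f : EuclideanSpace ℝ (Fin n) → ℝ} (hf : ContDiff ℝ ∞ f)
    (hc : HasCompactSupport f) (β : Fin n → ℕ) :
    ∃ C : ℝ, ∀ x y, |multiDeriv β f x| ≤ C ∧
      |multiDeriv β f x - multiDeriv β f y| ≤ C * ‖x - y‖ := by
  have hc' : HasCompactSupport (multiDeriv β f) :=
    hc.of_isClosed_subset (isClosed_tsupport _) (tsupport_multiDeriv_subset f β)
  obtain ⟨C₁, h₁⟩ := hc'.exists_bound_of_continuous (hf.multiDeriv β).continuous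
  obtain ⟨C₂, h₂⟩ := (hf.multiDeriv β).lipschitzWith_of_hasCompactSupport hc' (by simp)
  refine ⟨max C₁ C₂, fun x y => ⟨(h₁ x).trans (le_max_left _ _), ?_⟩⟩
  refine (h₂.norm_sub_le x y).trans ?_
  gcongr
  exact le_max_right _ _

end PartialDeriv

/-! ### Bump functions on dyadic cubes -/

namespace DyadicCube

variable {n : ℕ}

/-- The bump function on a dyadic cube obtained from a bump function of one variable. -/
def bump (b : ContDiffBump (0 : ℝ)) (Q : DyadicCube n) (x : EuclideanSpace ℝ (Fin n)) : ℝ :=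
  ∏ i, b ((x i - Q.center i) / Q.side)

variable {b : ContDiffBump (0 : ℝ)}

theorem contDiff_bump (Q : DyadicCube n) : ContDiff ℝ ∞ (Q.bump b) := by
  refine contDiff_prod fun i _ => b.contDiff.comp ?_
  fun_prop

theorem bump_nonneg (Q : DyadicCube n) (x : EuclideanSpace ℝ (Fin n)) : 0 ≤ Q.bump b x :=
  Finset.prod_nonneg fun _ _ => b.nonneg

theorem bump_eq_one (hb : b.rIn = 1 / 2) {Q : DyadicCube n} {x : EuclideanSpace ℝ (Fin n)}
    (hx : x ∈ Q.toSet) : Q.bump b x = 1 := by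
  refine Finset.prod_eq_one fun i _ => b.one_of_mem_closedBall ?_
  have := Q.side_pos
  have h := abs_le.1 (Q.toSet_subset_dilate le_rfl hx i)
  rw [mem_closedBall_zero_iff, Real.norm_eq_abs, hb, abs_le, le_div_iff₀ this, div_le_iff₀ this]
  constructor <;> linarith

theorem mem_dilate_of_bump_ne_zero {Q : DyadicCube n} {x : EuclideanSpace ℝ (Fin n)}
    (hx : Q.bump b x ≠ 0) : x ∈ Q.dilate (2 * b.rOut) := by
  intro i
  have h := Finset.prod_ne_zero_iff.1 hx i (Finset.mem_univ i)
  have hs := Q.side_pos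
  rw [← Function.mem_support, b.support_eq, mem_ball_zero_iff, Real.norm_eq_abs, abs_div,
    abs_of_pos hs, div_lt_iff₀ hs] at h
  linarith

/-- The translation part of `rescale`. -/
def shift (Q : DyadicCube n) : EuclideanSpace ℝ (Fin n) :=
  WithLp.toLp 2 fun i => Q.side * (2 * (Q.m i / 2 : ℤ))

/-- The affine map that takes `Q` to `Q.base`. -/
def rescale (Q : DyadicCube n) (x : EuclideanSpace ℝ (Fin n)) : EuclideanSpace ℝ (Fin n) :=
  Q.side⁻¹ • (x - Q.shift)

/-- The dyadic cube of side length one in `[0, 2) ^ n` at the same position in its parent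
as `Q`. -/
def base (Q : DyadicCube n) : DyadicCube n := ⟨0, fun i => Q.m i % 2⟩

/-- The preimage of `P` under `Q.rescale`, for `P.k ≤ 1`. -/
def place (Q P : DyadicCube n) : DyadicCube n :=
  ⟨P.k + Q.k, fun i => P.m i + 2 ^ (1 - P.k).toNat * (Q.m i / 2)⟩

theorem place_base (Q : DyadicCube n) : Q.place Q.base = Q := by
  refine DyadicCube.ext (zero_add _) (funext fun i => ?_)
  simp only [place, base]
  norm_num
  omega

theorem place_injective (Q : DyadicCube n) : Function.Injective Q.place := by
  intro P P' h
  have hk : P.k = P'.k := add_right_cancel (congrArg DyadicCube.k h)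
  refine DyadicCube.ext hk (funext fun i => ?_)
  have hm := congrFun (congrArg DyadicCube.m h) i
  simp only [place, hk] at hm
  exact add_right_cancel hm

/-- The rescaling is centred at a corner of the parent of Q, not of Q: this corner lies on the grid
of scale `Q.k + 1`, so cubes one scale larger than Q also become dyadic. -/
theorem bump_place {Q P : DyadicCube n} (hP : P.k ≤ 1) (x : EuclideanSpace ℝ (Fin n)) :
    (Q.place P).bump b x = P.bump b (Q.rescale x) := by
  refine Finset.prod_congr rfl fun i _ => congrArg b ?_
  have hs : (2 : ℝ) ^ Q.k ≠ 0 := by positivity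
  have ht : (2 : ℝ) ^ P.k ≠ 0 := by positivity
  have h2 : (2 : ℝ) ^ (1 - P.k).toNat = 2 / 2 ^ P.k := by
    rw [← zpow_natCast, Int.toNat_of_nonneg (by omega), zpow_sub₀ two_ne_zero, zpow_one]
  simp only [center_apply, rescale, shift, PiLp.smul_apply, PiLp.sub_apply, smul_eq_mul, side,
    place, zpow_add₀ (two_ne_zero' ℝ)]
  push_cast
  rw [h2]
  field_simp
  ring

open Classical in
/-- The dyadic cubes near the origin with side length `1 / 2`, `1` or `2`. -/
def box (n : ℕ) : Finset (DyadicCube n) :=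
  (Finset.Icc (-1) 1 ×ˢ Fintype.piFinset fun _ => Finset.Icc (-8) 8).image fun p => ⟨p.1, p.2⟩

theorem mem_box {P : DyadicCube n} :
    P ∈ box n ↔ (-1 ≤ P.k ∧ P.k ≤ 1) ∧ ∀ i, -8 ≤ P.m i ∧ P.m i ≤ 8 := by
  simp only [box, Finset.mem_image, Finset.mem_product, Finset.mem_Icc, Fintype.mem_piFinset]
  constructor
  · rintro ⟨p, hp, rfl⟩
    exact hp
  · exact fun h => ⟨(P.k, P.m), h, rfl⟩

theorem base_mem_box (Q : DyadicCube n) : Q.base ∈ box n := by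
  rw [mem_box]
  simp only [base]
  exact ⟨by norm_num, fun i => by omega⟩

theorem exists_place_eq {Q P : DyadicCube n} (h₁ : Q.k ≤ P.k + 1) (h₂ : P.k ≤ Q.k + 1)
    {x : EuclideanSpace ℝ (Fin n)} (hx : x ∈ Q.dilate 2) (hx' : x ∈ P.dilate 2) :
    ∃ R ∈ box n, Q.place R = P := by
  refine ⟨⟨P.k - Q.k, fun i => P.m i - 2 ^ (1 - (P.k - Q.k)).toNat * (Q.m i / 2)⟩, ?_,
    DyadicCube.ext (by simp [place]) (by simp [place])⟩
  refine mem_box.2 ⟨⟨by simp only; omega, by simp only; omega⟩, fun i => ?_⟩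
  have hs : (2 : ℝ) ^ Q.k ≠ 0 := by positivity
  have ht : (2 : ℝ) ^ P.k ≠ 0 := by positivity
  have h2 : P.side * (2 : ℝ) ^ (1 - (P.k - Q.k)).toNat = 2 * Q.side := by
    rw [← zpow_natCast, Int.toNat_of_nonneg (by omega), zpow_sub₀ two_ne_zero, zpow_one,
      zpow_sub₀ two_ne_zero, side, side]
    field_simp
  have hQ := Q.side_pos
  have hP := P.side_pos
  have hQP := side_le_two_mul h₁
  have e1 := abs_le.1 (hx i)
  have e2 := abs_le.1 (hx' i)
  rw [center_apply] at e1 e2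
  obtain ⟨q, hq⟩ : ∃ q, q = Q.m i / 2 := ⟨_, rfl⟩
  have hq1 : (2 * q : ℝ) ≤ Q.m i := by exact_mod_cast (by omega : 2 * q ≤ Q.m i)
  have hq2 : (Q.m i : ℝ) ≤ 2 * q + 1 := by exact_mod_cast (by omega : Q.m i ≤ 2 * q + 1)
  have hq3 := mul_le_mul_of_nonneg_left hq1 hQ.le
  have hq4 := mul_le_mul_of_nonneg_left hq2 hQ.le
  simp only
  rw [← hq]
  obtain ⟨z, hz⟩ : ∃ z, z = P.m i - 2 ^ (1 - (P.k - Q.k)).toNat * q := ⟨_, rfl⟩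
  have hz' : P.side * z = P.side * P.m i - 2 * Q.side * q := by
    rw [hz, ← h2]
    push_cast
    ring
  rw [← hz]
  -- The bound 8 is crude; only its independence of Q and P matters.
  have h3 : (-8 : ℝ) ≤ z := le_of_mul_le_mul_left (by linarith) hP
  have h4 : (z : ℝ) ≤ 8 := le_of_mul_le_mul_left (by linarith) hP
  exact ⟨by exact_mod_cast h3, by exact_mod_cast h4⟩

end DyadicCube

/-! ### The partition of unity -/

namespace DyadicCube

variable {n : ℕ}

/-- The bump function of `Q` normalised by the bump functions of the cubes in `A`. -/
def normBump (b : ContDiffBump (0 : ℝ)) (Q : DyadicCube n) (A : Finset (DyadicCube n))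
    (x : EuclideanSpace ℝ (Fin n)) : ℝ :=
  Q.bump b x / √(∑ P ∈ A, P.bump b x ^ 2)

variable {b : ContDiffBump (0 : ℝ)}

theorem tsupport_normBump_subset (Q : DyadicCube n) (A : Finset (DyadicCube n)) :
    tsupport (normBump b Q A) ⊆ Q.dilate (2 * b.rOut) := by
  refine closure_minimal (fun x hx => mem_dilate_of_bump_ne_zero (b := b) fun h => hx ?_)
    (Q.isClosed_dilate _)
  rw [normBump, h, zero_div]

/-- One constant serves all cubes because `box n` has finitely many members and subsets. Smoothness
is assumed since the denominator may vanish for an arbitrary A. -/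
theorem exists_bound_multiDeriv_normBump (b : ContDiffBump (0 : ℝ)) (n : ℕ) (β : Fin n → ℕ) :
    ∃ C : ℝ, 0 < C ∧ ∀ Q ∈ box n, ∀ A ⊆ box n, ContDiff ℝ ∞ (normBump b Q A) → ∀ x y,
      |multiDeriv β (normBump b Q A) x| ≤ C ∧
      |multiDeriv β (normBump b Q A) x - multiDeriv β (normBump b Q A) y| ≤ C * ‖x - y‖ := by
  have h : ∀ p : DyadicCube n × Finset (DyadicCube n), ∃ C : ℝ,
      ContDiff ℝ ∞ (normBump b p.1 p.2) → ∀ x y, |multiDeriv β (normBump b p.1 p.2) x| ≤ C ∧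
      |multiDeriv β (normBump b p.1 p.2) x - multiDeriv β (normBump b p.1 p.2) y| ≤
        C * ‖x - y‖ := by
    intro p
    by_cases hp : ContDiff ℝ ∞ (normBump b p.1 p.2)
    · obtain ⟨C, hC⟩ := exists_bound_multiDeriv hp ((p.1.isCompact_dilate _).of_isClosed_subset
        (isClosed_tsupport _) (tsupport_normBump_subset p.1 p.2)) β
      exact ⟨C, fun _ => hC⟩
    · exact ⟨0, fun h => absurd h hp⟩
  choose C hC using h
  obtain ⟨M, hM⟩ := ((box n ×ˢ (box n).powerset).image C).bddAbove
  refine ⟨max M 1, by positivity, fun Q hQ A hA hQA x y => ?_⟩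
  have hCM : C (Q, A) ≤ max M 1 := le_max_of_le_left <| hM <| Finset.mem_coe.2 <|
    Finset.mem_image_of_mem C (Finset.mk_mem_product hQ (Finset.mem_powerset.2 hA))
  obtain ⟨h₁, h₂⟩ := hC (Q, A) hQA x y
  refine ⟨h₁.trans hCM, h₂.trans ?_⟩
  gcongr

open Classical in
/-- The Whitney cubes near `Q`, rescaled by `Q.rescale`. -/
def config (r : EuclideanSpace ℝ (Fin n) → ℝ) (δ : ℝ) (Q : DyadicCube n) :
    Finset (DyadicCube n) :=
  (box n).filter fun P => (Q.place P).IsWhitney r δ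

theorem config_subset_box (r : EuclideanSpace ℝ (Fin n) → ℝ) (δ : ℝ) (Q : DyadicCube n) :
    Q.config r δ ⊆ box n := by
  classical
  exact Finset.filter_subset _ _

open Classical in
/-- The bump function of a Whitney cube, and zero for all other dyadic cubes. -/
def whitneyBump (b : ContDiffBump (0 : ℝ)) (r : EuclideanSpace ℝ (Fin n) → ℝ) (δ : ℝ)
    (Q : DyadicCube n) (x : EuclideanSpace ℝ (Fin n)) : ℝ :=
  if Q.IsWhitney r δ then Q.bump b x else 0

/-- The sum of the squares of the bump functions of the Whitney cubes near `Q`. -/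
def localSum (b : ContDiffBump (0 : ℝ)) (r : EuclideanSpace ℝ (Fin n) → ℝ) (δ : ℝ)
    (Q : DyadicCube n) (x : EuclideanSpace ℝ (Fin n)) : ℝ :=
  ∑ P ∈ Q.config r δ, P.bump b (Q.rescale x) ^ 2

/-- The member of the partition of unity that belongs to the dyadic cube `Q`. -/
def whitneyFun (b : ContDiffBump (0 : ℝ)) (r : EuclideanSpace ℝ (Fin n) → ℝ) (δ : ℝ)
    (Q : DyadicCube n) (x : EuclideanSpace ℝ (Fin n)) : ℝ :=
  whitneyBump b r δ Q x / √(localSum b r δ Q x)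

variable {r : EuclideanSpace ℝ (Fin n) → ℝ} {δ : ℝ} {Q : DyadicCube n}

theorem whitneyBump_of (hQ : Q.IsWhitney r δ) : whitneyBump b r δ Q = Q.bump b :=
  funext fun _ => if_pos hQ

theorem whitneyFun_of (hQ : Q.IsWhitney r δ) :
    whitneyFun b r δ Q = fun x => normBump b Q.base (Q.config r δ) (Q.rescale x) := by
  funext x
  rw [whitneyFun, whitneyBump_of hQ, normBump, localSum, ← bump_place (by simp [base]), place_base]

theorem whitneyFun_of_not (hQ : ¬ Q.IsWhitney r δ) : whitneyFun b r δ Q = 0 := by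
  funext x
  simp [whitneyFun, whitneyBump, hQ]

theorem isWhitney_and_mem_of_whitneyBump_ne_zero {x : EuclideanSpace ℝ (Fin n)}
    (hx : whitneyBump b r δ Q x ≠ 0) : Q.IsWhitney r δ ∧ x ∈ Q.dilate (2 * b.rOut) := by
  by_cases hQ : Q.IsWhitney r δ
  · rw [whitneyBump_of hQ] at hx
    exact ⟨hQ, mem_dilate_of_bump_ne_zero hx⟩
  · simp [whitneyBump, hQ] at hx

theorem isWhitney_and_mem_of_whitneyFun_ne_zero {x : EuclideanSpace ℝ (Fin n)}
    (hx : whitneyFun b r δ Q x ≠ 0) : Q.IsWhitney r δ ∧ x ∈ Q.dilate (2 * b.rOut) :=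
  isWhitney_and_mem_of_whitneyBump_ne_zero (b := b) fun h => hx (by rw [whitneyFun, h, zero_div])

theorem whitneyFun_nonneg (x : EuclideanSpace ℝ (Fin n)) : 0 ≤ whitneyFun b r δ Q x := by
  refine div_nonneg ?_ (Real.sqrt_nonneg _)
  unfold whitneyBump
  split_ifs
  exacts [bump_nonneg _ _, le_rfl]

theorem tsupport_whitneyFun_subset : tsupport (whitneyFun b r δ Q) ⊆ Q.dilate (2 * b.rOut) :=
  closure_minimal (fun _ hx => (isWhitney_and_mem_of_whitneyFun_ne_zero hx).2)
    (Q.isClosed_dilate _)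

theorem contDiff_localSum : ContDiff ℝ ∞ (localSum b r δ Q) := by
  refine ContDiff.sum fun P _ => (P.contDiff_bump.comp ?_).pow 2
  unfold rescale
  fun_prop

end DyadicCube

/-! ### Sum of squares, smoothness and derivative estimates. -/

namespace SlowAt

open DyadicCube

variable {n : ℕ} {r : EuclideanSpace ℝ (Fin n) → ℝ} {δ : ℝ} {b : ContDiffBump (0 : ℝ)}

/-- A Whitney cube whose bump is non-zero at x has a double meeting that of Q, hence belongs to the
finite configuration of Q. So the finite smooth local sum equals the global one on the doubled cube.
-/
theorem hasSum_whitneyBump_sq (h : SlowAt r δ) (hb : b.rOut ≤ 1) {Q : DyadicCube n}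
    (hQ : Q.IsWhitney r δ) {x : EuclideanSpace ℝ (Fin n)} (hx : x ∈ Q.dilate 2) :
    HasSum (fun P => whitneyBump b r δ P x ^ 2) (localSum b r δ Q x) := by
  classical
  have hsum : localSum b r δ Q x =
      ∑ P ∈ (Q.config r δ).image Q.place, whitneyBump b r δ P x ^ 2 := by
    rw [Finset.sum_image Q.place_injective.injOn]
    refine Finset.sum_congr rfl fun P hP => ?_
    obtain ⟨hP₁, hP₂⟩ := Finset.mem_filter.1 hP
    rw [whitneyBump_of hP₂, bump_place (mem_box.1 hP₁).1.2]
  rw [hsum]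
  refine hasSum_sum_of_ne_finset_zero fun P hP => ?_
  by_contra hne
  obtain ⟨hPW, hPx⟩ := isWhitney_and_mem_of_whitneyBump_ne_zero (b := b)
    (fun h0 => hne (by rw [h0]; norm_num))
  have hP2 : 2 * b.rOut ≤ 2 := by linarith
  replace hPx := dilate_mono hP2 _ hPx
  obtain ⟨R, hR, rfl⟩ := exists_place_eq (h.k_le hQ hPW hx hPx) (h.k_le hPW hQ hPx hx) hx hPx
  exact hP (Finset.mem_image_of_mem _ (Finset.mem_filter.2 ⟨hR, hPW⟩))

theorem one_le_localSum (h : SlowAt r δ) (hb : b.rOut ≤ 1) (hb' : b.rIn = 1 / 2)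
    {Q : DyadicCube n} (hQ : Q.IsWhitney r δ) {x : EuclideanSpace ℝ (Fin n)}
    (hx : x ∈ Q.dilate 2) : 1 ≤ localSum b r δ Q x := by
  obtain ⟨P, hP, hxP⟩ := h.exists_isWhitney (h.pos_of_mem_dilate hQ hx)
  have := le_hasSum (h.hasSum_whitneyBump_sq hb hQ hx) P fun _ _ => sq_nonneg _
  rwa [whitneyBump_of hP, bump_eq_one hb' hxP, one_pow] at this

/-- The denominator is at least 1 on the closed dilate carrying the bump; off it the function
vanishes locally, so zeros of the local sum there are harmless. -/
theorem contDiff_whitneyFun (h : SlowAt r δ) (hb : b.rOut ≤ 1) (hb' : b.rIn = 1 / 2)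
    (Q : DyadicCube n) : ContDiff ℝ ∞ (whitneyFun b r δ Q) := by
  by_cases hQ : Q.IsWhitney r δ
  swap
  · rw [whitneyFun_of_not hQ]
    exact contDiff_const
  refine contDiff_iff_contDiffAt.2 fun x => ?_
  by_cases hx : x ∈ Q.dilate (2 * b.rOut)
  · have h1 := h.one_le_localSum hb hb' hQ (dilate_mono (by linarith) _ hx)
    unfold whitneyFun
    rw [whitneyBump_of hQ]
    exact Q.contDiff_bump.contDiffAt.div (contDiff_localSum.contDiffAt.sqrt (by linarith))
      (Real.sqrt_ne_zero'.2 (by linarith))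
  · have h1 : whitneyFun b r δ Q =ᶠ[𝓝 x] fun _ => 0 :=
      notMem_tsupport_iff_eventuallyEq.1 fun hx' => hx (tsupport_whitneyFun_subset hx')
    exact contDiffAt_const.congr_of_eventuallyEq h1

theorem hasSum_whitneyFun_sq (h : SlowAt r δ) (hb : b.rOut ≤ 1) (hb' : b.rIn = 1 / 2)
    (x : EuclideanSpace ℝ (Fin n)) :
    HasSum (fun Q => whitneyFun b r δ Q x ^ 2)
      (Set.indicator {y | 0 < r y} (fun _ => (1 : ℝ)) x) := by
  by_cases hx : 0 < r x
  · rw [Set.indicator_of_mem (by exact hx)]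
    obtain ⟨P, hP, hxP⟩ := h.exists_isWhitney hx
    have hxP' := P.toSet_subset_dilate one_le_two hxP
    have h1 := h.one_le_localSum hb hb' hP hxP'
    have h2 := h.hasSum_whitneyBump_sq hb hP hxP'
    have h3 := h2.div_const (localSum b r δ P x)
    rw [div_self (by linarith)] at h3
    convert! h3 using 2 with Q
    by_cases hQx : whitneyBump b r δ Q x = 0
    · simp [whitneyFun, hQx]
    obtain ⟨hQ, hxQ⟩ := isWhitney_and_mem_of_whitneyBump_ne_zero hQx
    have h4 := h.hasSum_whitneyBump_sq hb hQ (dilate_mono (by linarith) _ hxQ)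
    -- Local sums of different cubes agree at x, being the sum of the same series.
    rw [whitneyFun, div_pow, h4.unique h2, Real.sq_sqrt (by linarith)]
  · rw [Set.indicator_of_notMem (by exact hx)]
    convert! hasSum_zero using 2 with Q
    by_contra hne
    obtain ⟨hQ, hxQ⟩ := isWhitney_and_mem_of_whitneyFun_ne_zero
      (fun h0 => hne (by rw [h0]; norm_num))
    exact hx (h.pos_of_mem_dilate hQ (dilate_mono (by linarith) _ hxQ))

/-- The rescaled bounds for the derivatives of the members of the partition of unity. -/
theorem exists_bound_multiDeriv_whitneyFun (h : SlowAt r δ) (hb : b.rOut ≤ 1)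
    (hb' : b.rIn = 1 / 2) (β : Fin n → ℕ) : ∃ C : ℝ, 0 < C ∧ ∀ Q : DyadicCube n, ∀ x y,
      |multiDeriv β (whitneyFun b r δ Q) x| ≤ C * Q.side⁻¹ ^ (∑ i, β i) ∧
      |multiDeriv β (whitneyFun b r δ Q) x - multiDeriv β (whitneyFun b r δ Q) y| ≤
        C * Q.side⁻¹ ^ (∑ i, β i) * (Q.side⁻¹ * ‖x - y‖) := by
  obtain ⟨C, hC, hbound⟩ := exists_bound_multiDeriv_normBump b n β
  refine ⟨C, hC, fun Q x y => ?_⟩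
  have hs := Q.side_pos
  by_cases hQ : Q.IsWhitney r δ
  swap
  · rw [whitneyFun_of_not hQ, multiDeriv_zero]
    simp only [Pi.zero_apply, sub_zero, abs_zero]
    constructor <;> positivity
  have hsmooth : ContDiff ℝ ∞ (normBump b Q.base (Q.config r δ)) := by
    -- Smoothness of the normalised model is pulled back from `whitneyFun` through the inverse
    -- rescaling.
    have h1 : normBump b Q.base (Q.config r δ) =
        fun u => whitneyFun b r δ Q (Q.shift + Q.side • u) := by
      funext u
      simp only [whitneyFun_of hQ]
      rw [rescale, add_sub_cancel_left, inv_smul_smul₀ hs.ne']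
    rw [h1]
    refine (h.contDiff_whitneyFun hb hb' Q).comp ?_
    fun_prop
  have hb2 := hbound Q.base Q.base_mem_box (Q.config r δ) (Q.config_subset_box r δ) hsmooth
    (Q.rescale x) (Q.rescale y)
  have hd : multiDeriv β (whitneyFun b r δ Q) = fun x => Q.side⁻¹ ^ (∑ i, β i) *
      multiDeriv β (normBump b Q.base (Q.config r δ)) (Q.rescale x) := by
    rw [whitneyFun_of hQ]
    exact multiDeriv_comp_smul_sub _ β _ _
  have hn : ‖Q.rescale x - Q.rescale y‖ = Q.side⁻¹ * ‖x - y‖ := by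
    rw [rescale, rescale, ← smul_sub, sub_sub_sub_cancel_right, norm_smul, norm_inv,
      Real.norm_of_nonneg hs.le]
  rw [hn] at hb2
  have hp : 0 ≤ Q.side⁻¹ ^ (∑ i, β i) := by positivity
  simp only [hd]
  rw [← mul_sub, abs_mul, abs_mul, abs_of_nonneg hp, mul_comm C, mul_assoc]
  exact ⟨mul_le_mul_of_nonneg_left hb2.1 hp, mul_le_mul_of_nonneg_left hb2.2 hp⟩

theorem inv_side_le (h : SlowAt r δ) {Q : DyadicCube n} (hQ : Q.IsWhitney r δ)
    {x : EuclideanSpace ℝ (Fin n)} (hx : x ∈ Q.dilate 2) :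
    Q.side⁻¹ ≤ 18 / 7 / δ * (r x)⁻¹ := by
  have h1 := (h.side_bounds hQ hx).2
  have h2 := h.pos_of_mem_dilate hQ hx
  have h3 := Q.side_pos
  have h4 := h.pos
  rw [inv_le_comm₀ h3 (by positivity), mul_inv, inv_inv, inv_div, div_mul_eq_mul_div,
    div_le_iff₀ (by norm_num)]
  linarith

theorem isWhitney_and_mem_of_mem_tsupport (hb : b.rOut ≤ 1) {β : Fin n → ℕ} {Q : DyadicCube n}
    {x : EuclideanSpace ℝ (Fin n)} (hx : x ∈ tsupport (multiDeriv β (whitneyFun b r δ Q))) :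
    Q.IsWhitney r δ ∧ x ∈ Q.dilate 2 := by
  have h1 := tsupport_multiDeriv_subset _ _ hx
  refine ⟨?_, dilate_mono (by linarith) _ (tsupport_whitneyFun_subset h1)⟩
  by_contra hQ
  rw [whitneyFun_of_not hQ] at h1
  simp [tsupport] at h1

theorem exists_abs_multiDeriv_whitneyFun_le (h : SlowAt r δ) (hb : b.rOut ≤ 1)
    (hb' : b.rIn = 1 / 2) (β : Fin n → ℕ) : ∃ C : ℝ, 0 < C ∧ ∀ (Q : DyadicCube n) x, 0 < r x →
      |multiDeriv β (whitneyFun b r δ Q) x| ≤ C * r x ^ (-((∑ i, β i : ℕ) : ℝ)) := by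
  obtain ⟨C, hC, hbound⟩ := h.exists_bound_multiDeriv_whitneyFun hb hb' β
  have hδ := h.pos
  refine ⟨C * (18 / 7 / δ) ^ (∑ i, β i), by positivity, fun Q x hrx => ?_⟩
  rw [Real.rpow_neg hrx.le, Real.rpow_natCast, ← inv_pow, mul_assoc, ← mul_pow]
  by_cases hx : x ∈ tsupport (multiDeriv β (whitneyFun b r δ Q))
  · obtain ⟨hQ, hxQ⟩ := isWhitney_and_mem_of_mem_tsupport hb hx
    refine (hbound Q x x).1.trans ?_
    have := h.inv_side_le hQ hxQ
    have := Q.side_pos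
    gcongr
  · rw [image_eq_zero_of_notMem_tsupport hx, abs_zero]
    positivity

theorem exists_holderSeminormAt_multiDeriv_whitneyFun_le (h : SlowAt r δ) (hb : b.rOut ≤ 1)
    (hb' : b.rIn = 1 / 2) (β : Fin n → ℕ) (α : ℝ) (hα : 0 < α) (hα' : α ≤ 1) :
    ∃ C : ℝ, 0 < C ∧ ∀ (Q : DyadicCube n) x, 0 < r x →
      holderSeminormAt α (multiDeriv β (whitneyFun b r δ Q)) x ≤
        ENNReal.ofReal (C * r x ^ (-α - ((∑ i, β i : ℕ) : ℝ))) := by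
  obtain ⟨C, hC, hbound⟩ := h.exists_bound_multiDeriv_whitneyFun hb hb' β
  have hδ := h.pos
  refine ⟨C * (18 / 7 / δ) ^ (∑ i, β i) * (18 / 7 / δ) ^ α, by positivity, fun Q x hrx => ?_⟩
  have hright : C * (18 / 7 / δ) ^ (∑ i, β i) * (18 / 7 / δ) ^ α *
      r x ^ (-α - ((∑ i, β i : ℕ) : ℝ)) =
      C * (18 / 7 / δ * (r x)⁻¹) ^ (∑ i, β i) * (18 / 7 / δ * (r x)⁻¹) ^ α := by
    rw [sub_eq_add_neg, Real.rpow_add hrx, Real.rpow_neg hrx.le, Real.rpow_neg hrx.le,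
      Real.rpow_natCast, mul_pow, Real.mul_rpow (by positivity) (by positivity),
      Real.inv_rpow hrx.le, inv_pow]
    ring
  rw [hright]
  unfold holderSeminormAt
  by_cases hx : x ∈ tsupport (multiDeriv β (whitneyFun b r δ Q))
  · obtain ⟨hQ, hxQ⟩ := isWhitney_and_mem_of_mem_tsupport hb hx
    have hs := Q.side_pos
    have hnear : ∀ᶠ p : EuclideanSpace ℝ (Fin n) × EuclideanSpace ℝ (Fin n) in 𝓝 (x, x),
        ‖p.1 - p.2‖ < Q.side := by
      refine ContinuousAt.eventually_lt (by fun_prop) continuousAt_const ?_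
      simpa using hs
    refine limsup_le_of_le (by isBoundedDefault) ?_
    filter_upwards [mem_nhdsWithin_of_mem_nhds hnear, self_mem_nhdsWithin] with p hp hne
    refine ENNReal.ofReal_le_ofReal ?_
    have hd : 0 < ‖p.1 - p.2‖ := norm_pos_iff.2 (sub_ne_zero.2 hne)
    rw [div_le_iff₀ (by positivity)]
    refine (hbound Q p.1 p.2).2.trans ?_
    rw [mul_assoc (C * _), ← Real.mul_rpow (by positivity) (by positivity)]
    -- Points closer than the side have scaled distance at most 1, so the Lipschitz bound implies
    -- the Hölder bound.
    have h1 : Q.side⁻¹ * ‖p.1 - p.2‖ ≤ (Q.side⁻¹ * ‖p.1 - p.2‖) ^ α := by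
      refine Real.self_le_rpow_of_le_one (by positivity) ?_ hα'
      rw [inv_mul_le_one₀ hs]
      exact le_of_lt hp
    have h2 := h.inv_side_le hQ hxQ
    refine (mul_le_mul_of_nonneg_left h1 (by positivity)).trans ?_
    gcongr
  · have h1 : ∀ᶠ y in 𝓝 x, multiDeriv β (whitneyFun b r δ Q) y = 0 :=
      notMem_tsupport_iff_eventuallyEq.1 hx
    refine limsup_le_of_le (by isBoundedDefault) ?_
    have h2 := h1.prod_nhds h1
    filter_upwards [mem_nhdsWithin_of_mem_nhds h2] with p hp
    simp [hp.1, hp.2]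

/-- Colourings of the Whitney cubes separate the supports. -/
theorem exists_color (hb : b.rOut ≤ 9 / 16) {k : ℕ} (hk : 0 < k)
    (hcol : (whitneyGraph r δ).Colorable k) : ∃ color : DyadicCube n → Fin k, ∀ Q P, Q ≠ P →
      color Q = color P →
        Disjoint (tsupport (whitneyFun b r δ Q)) (tsupport (whitneyFun b r δ P)) := by
  classical
  obtain ⟨c⟩ := hcol
  refine ⟨fun Q => if hQ : Q.IsWhitney r δ then c ⟨Q, hQ⟩ else ⟨0, hk⟩, fun Q P hne heq => ?_⟩
  by_cases hQ : Q.IsWhitney r δ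
  swap
  · simp [whitneyFun_of_not hQ, tsupport]
  by_cases hP : P.IsWhitney r δ
  swap
  · simp [whitneyFun_of_not hP, tsupport]
  simp only [dif_pos hQ, dif_pos hP] at heq
  refine Set.disjoint_iff_inter_eq_empty.2 (Set.not_nonempty_iff_eq_empty.1 ?_)
  rintro ⟨x, hx, hx'⟩
  refine c.valid (v := ⟨Q, hQ⟩) (w := ⟨P, hP⟩) ⟨fun h => hne (congrArg Subtype.val h), x,
    ?_, ?_⟩ heq
  · exact dilate_mono (by linarith) _ (tsupport_whitneyFun_subset hx)
  · exact dilate_mono (by linarith) _ (tsupport_whitneyFun_subset hx')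

end SlowAt

/-- All dyadic cubes are enumerated, with zero functions on non-Whitney ones; this gives an infinite
sequence of distinct cubes even if few or no Whitney cubes exist. -/
theorem DyadicCube.nonempty_equiv_nat (n : ℕ) : Nonempty (ℕ ≃ DyadicCube n) := by
  have h1 : Countable (DyadicCube n) :=
    Function.Injective.countable (f := fun Q : DyadicCube n => (Q.k, Q.m)) fun Q P h =>
      DyadicCube.ext (congrArg Prod.fst h) (congrArg Prod.snd h)
  have h2 : Infinite (DyadicCube n) :=
    Infinite.of_injective (fun k : ℤ => (⟨k, 0⟩ : DyadicCube n)) fun _ _ h =>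
      congrArg DyadicCube.k h
  exact nonempty_equiv_of_countable

end

theorem mainTheorem7 (n : ℕ) (hn : 1 ≤ n) (r : EuclideanSpace ℝ (Fin n) → ℝ)
    (hr : SlowlyVarying r) (lam : ℝ) (hlam₁ : 1 < lam) (hlam₂ : lam < 3 / 2) :
    ∃ (Q : ℕ → DyadicCube n) (ψ : ℕ → EuclideanSpace ℝ (Fin n) → ℝ),
      Function.Injective Q ∧
      (∀ j, ContDiff ℝ ∞ (ψ j)) ∧
      (∀ j x, 0 ≤ ψ j x) ∧
      (∀ j, tsupport (ψ j) ⊆ (Q j).dilate lam) ∧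
      (∀ x, HasSum (fun j => ψ j x ^ 2) (Set.indicator {y | 0 < r y} (fun _ => (1 : ℝ)) x)) ∧
      (∀ x, {j | ψ j x ≠ 0}.encard ≤ 2 ^ n) ∧
      (∀ β : Fin n → ℕ, ∃ C : ℝ, 0 < C ∧ ∀ j x, 0 < r x →
        |multiDeriv β (ψ j) x| ≤ C * r x ^ (-((∑ i, β i : ℕ) : ℝ))) ∧
      (∀ (β : Fin n → ℕ) (α : ℝ), 0 < α → α ≤ 1 → ∃ C : ℝ, 0 < C ∧ ∀ j x, 0 < r x →
        holderSeminormAt α (multiDeriv β (ψ j)) x ≤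
          ENNReal.ofReal (C * r x ^ (-α - ((∑ i, β i : ℕ) : ℝ)))) ∧
      (∃ color : ℕ → Fin (4 ^ n - 2 ^ n), ∀ i j, i ≠ j → color i = color j →
        Disjoint (tsupport (ψ i)) (tsupport (ψ j))) ∧
      (n = 2 → ∃ color : ℕ → Fin 9, ∀ i j, i ≠ j → color i = color j →
        Disjoint (tsupport (ψ i)) (tsupport (ψ j))) := by
  obtain ⟨δ, h⟩ := hr.exists_slowAt hn
  obtain ⟨e⟩ := DyadicCube.nonempty_equiv_nat n
  have hlam : 1 < min lam (9 / 8) := lt_min hlam₁ (by norm_num)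
  -- The cap λ gives the required supports, the cap 9/8 the overlap and colouring bounds.
  let b : ContDiffBump (0 : ℝ) := ⟨1 / 2, min lam (9 / 8) / 2, by norm_num, by linarith⟩
  have hb' : b.rIn = 1 / 2 := rfl
  have hbl : 2 * b.rOut = min lam (9 / 8) := mul_div_cancel₀ _ two_ne_zero
  have hb9 : b.rOut ≤ 9 / 16 := by
    have := min_le_right lam (9 / 8)
    linarith
  have hb : b.rOut ≤ 1 := by linarith
  have hcolor : ∀ k, 0 < k → (whitneyGraph r δ).Colorable k → ∃ color : ℕ → Fin k,
      ∀ i j, i ≠ j → color i = color j → Disjoint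
        (tsupport (DyadicCube.whitneyFun b r δ (e i)))
        (tsupport (DyadicCube.whitneyFun b r δ (e j))) := by
    intro k hk hcol
    obtain ⟨c, hc⟩ := SlowAt.exists_color hb9 hk hcol
    exact ⟨c ∘ e, fun i j hij => hc _ _ (e.injective.ne hij)⟩
  refine ⟨e, fun j => DyadicCube.whitneyFun b r δ (e j), e.injective,
    fun j => h.contDiff_whitneyFun hb hb' (e j), fun j => DyadicCube.whitneyFun_nonneg,
    fun j => ?_, fun x => e.hasSum_iff.2 (h.hasSum_whitneyFun_sq hb hb' x), fun x => ?_,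
    fun β => ?_, fun β α hα hα' => ?_, hcolor _ ?_ h.colorable, ?_⟩
  · refine DyadicCube.tsupport_whitneyFun_subset.trans (DyadicCube.dilate_mono ?_ _)
    exact hbl.trans_le (min_le_left _ _)
  · refine le_trans ?_ (h.encard_le x)
    refine Set.encard_le_encard_of_injOn (f := e) (fun j hj => ?_) e.injective.injOn
    obtain ⟨h1, h2⟩ := DyadicCube.isWhitney_and_mem_of_whitneyFun_ne_zero hj
    exact ⟨h1, DyadicCube.dilate_mono (by linarith) _ h2⟩
  · obtain ⟨C, hC, hbound⟩ := h.exists_abs_multiDeriv_whitneyFun_le hb hb' β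
    exact ⟨C, hC, fun j => hbound (e j)⟩
  · obtain ⟨C, hC, hbound⟩ :=
      h.exists_holderSeminormAt_multiDeriv_whitneyFun_le hb hb' β α hα hα'
    exact ⟨C, hC, fun j => hbound (e j)⟩
  · exact Nat.sub_pos_of_lt (Nat.pow_lt_pow_left (by norm_num) (by omega))
  · rintro rfl
    exact hcolor 9 (by norm_num) h.colorable_three_pow
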